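/- Fix $\sigma>0$. For $k\ge 1$ let Subject sit at the origin of $\mathbb{R}^k$, and let $X_1,X_2,\dots$ be independent and uniformly distributed on the closed Euclidean unit ball of $\mathbb{R}^k$. For a positive integer $m$ let $$d^{\mathrm{IP}}_k(m)=\mathbb{E}\Big[\min_{1\le i\le m}\|X_i\|\Big]$$ be the expected distance from Subject to the closest of $m$ people met in person. On the AI platform, in the interaction between Subject and individual $i$, individual $i$ is represented by the clone $Y_{i0}=X_i+\varepsilon_{i0}$ and Subject by the clone $Y_{0i}=\varepsilon_{0i}$, where $\varepsilon_{i0},\varepsilon_{0i}\sim\mathcal{N}(0,\sigma^2 I_k)$ and all the $X_i,\varepsilon_{i0},\varepsilon_{0i}$ are mutually independent. For a positive integer $n$ let $i^*_n=\operatorname{argmin}_{1\le i\le n}\|Y_{0i}-Y_{i0}\|$ (almost surely unique) and $$d^{\mathrm{AI}}_k(n)=\mathbb{E}\big[\|X_{i^*_n}\|\big].$$ The AI-equivalent sample size $m^*_k\in\{1,2,\dots\}\cup\{\infty\}$ is the smallest positive integer $m$ such that $d^{\mathrm{IP}}_k(m)<d^{\mathrm{AI}}_k(n)$ for all positive integers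 $n$, and $m^*_k=\infty$ if there is no such $m$. Theorem. There is a $K$, depending only on $\sigma$, such that for all $k\ge K$ one has $m^*_k=2$; in particular $d^{\mathrm{IP}}_k(2)<d^{\mathrm{AI}}_k(n)$ for all $n\ge 1$. Moreover, for every $k\ge 1$, $$d^{\mathrm{IP}}_k(1)=d^{\mathrm{AI}}_k(1)=\frac{k}{k+1}\qquad\text{and}\qquad d^{\mathrm{AI}}_k(n)<\frac{k}{k+1}=d^{\mathrm{IP}}_k(1)\quad\text{for all } n\ge 2,$$ so meeting one person in person never beats the AI platform. -/

import Mathlib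

open MeasureTheory ProbabilityTheory

noncomputable section

namespace AIClones

/-- The uniform distribution on the closed unit ball of `ℝ^k` (Euclidean norm). -/
def uniformBall (k : ℕ) : Measure (EuclideanSpace ℝ (Fin k)) :=
  ProbabilityTheory.cond volume (Metric.closedBall 0 1)

/-- The Gaussian distribution `N(0, σ² I_k)` on `ℝ^k`. -/
def gaussianNoise (σ : ℝ) (k : ℕ) : Measure (EuclideanSpace ℝ (Fin k)) :=
  multivariateGaussian 0 ((σ ^ 2) • (1 : Matrix (Fin k) (Fin k) ℝ))

/-- The position `x₀` of Subject: its attributes are normalized to the zero vector. -/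
def subject (k : ℕ) : EuclideanSpace ℝ (Fin k) := 0

/-- `d^IP_k(m)`: the expected distance between Subject and the closest of `m` independent
uniform draws from the unit ball. -/
def dIP (k : ℕ) (m : ℕ+) : ℝ :=
  ∫ x : Fin m → EuclideanSpace ℝ (Fin k),
    Finset.univ.inf' Finset.univ_nonempty (fun i => ‖x i - subject k‖)
    ∂(Measure.pi fun _ => uniformBall k)

/-- The random data `(X_i, ε_{i0}, ε_{0i})` of one candidate on the AI platform: the true
attributes, the noise in the candidate's clone, and the noise in Subject's clone. -/
abbrev Candidate (k : ℕ) : Type :=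
  EuclideanSpace ℝ (Fin k) × EuclideanSpace ℝ (Fin k) × EuclideanSpace ℝ (Fin k)

/-- The true attributes `X_i`. -/
def Candidate.attributes {k : ℕ} (c : Candidate k) : EuclideanSpace ℝ (Fin k) := c.1

/-- The candidate's clone `Y_{i0} = X_i + ε_{i0}`. -/
def Candidate.clone {k : ℕ} (c : Candidate k) : EuclideanSpace ℝ (Fin k) := c.1 + c.2.1

/-- Subject's clone `Y_{0i} = x₀ + ε_{0i}` in the interaction with this candidate. -/
def Candidate.subjectClone {k : ℕ} (c : Candidate k) : EuclideanSpace ℝ (Fin k) :=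
  subject k + c.2.2

/-- The distance `‖Y_{0i} - Y_{i0}‖` between the two clones. -/
def Candidate.cloneDist {k : ℕ} (c : Candidate k) : ℝ := ‖c.subjectClone - c.clone‖

/-- The law of a candidate: `X_i` uniform on the unit ball, `ε_{i0}, ε_{0i} ∼ N(0, σ² I_k)`,
all three independent. -/
def candidateLaw (σ : ℝ) (k : ℕ) : Measure (Candidate k) :=
  (uniformBall k).prod ((gaussianNoise σ k).prod (gaussianNoise σ k))

theorem exists_minimizer {n : ℕ+} (s : Fin n → ℝ) :
    (Finset.univ.filter fun i => ∀ j, s i ≤ s j).Nonempty := by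
  obtain ⟨i, -, hi⟩ := Finset.exists_min_image Finset.univ s Finset.univ_nonempty
  exact ⟨i, by simpa using hi⟩

/-- The index at which `s` is minimal (the smallest such index if there are ties). -/
def argmin {n : ℕ+} (s : Fin n → ℝ) : Fin n :=
  (Finset.univ.filter fun i => ∀ j, s i ≤ s j).min' (exists_minimizer s)

/-- `d^AI_k(n)`: the expected true distance between Subject and the candidate whose clone is
closest to Subject's clone, among `n` independent candidates. -/
def dAI (σ : ℝ) (k : ℕ) (n : ℕ+) : ℝ :=
  ∫ c : Fin n → Candidate k,
    ‖(c (argmin fun i => (c i).cloneDist)).attributes - subject k‖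
    ∂(Measure.pi fun _ => candidateLaw σ k)

/-- The AI-equivalent sample size `m*_k`: the smallest positive integer `m` such that
`d^IP_k(m) < d^AI_k(n)` for every positive integer `n`, and `∞` if there is no such `m`. -/
def aiEquivalentSampleSize (σ : ℝ) (k : ℕ) : ℕ∞ :=
  sInf {M : ℕ∞ | ∃ m : ℕ+, M = ((m : ℕ) : ℕ∞) ∧ ∀ n : ℕ+, dIP k m < dAI σ k n}

end AIClones

end

/-!
Let `w t` be the total probability, over the `n` places, that a candidate with clone distance `t`
is selected. By Fubini (`integral_argmin`), `d^AI_k(n) = E[‖X‖ w(D)]` for a single candidate with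
attributes `X` and clone distance `D`, where `w ≥ 0` is decreasing and `E[w(D)] = 1`. Hence
`v(x) = E[w(D) | X = x]` (`selectedDensity`) is the density of the attributes of the selected
candidate with respect to the uniform distribution. The difference of the two noises is
`N(0, 2σ² I_k)`, so up to a constant `v(x) = ∫ w(‖z - x‖) exp(-b‖z‖²) dz` with `b = (4σ²)⁻¹`. Two
properties of `v` carry the proof.

* `v` is a decreasing function of the norm, strictly so if `n ≥ 2` (`gaussianAverage_anti`,
  `gaussianAverage_strictAnti`): for `‖x‖ ≤ ‖x'‖`, reflection in the bisector of `x` and `x'`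
  exchanges the distances to `x` and to `x'` and lowers the Gaussian weight of the points on the
  side of `x`.
* `exp(b‖x‖²) v(x)` is an increasing function of the norm (`gaussianAverage_le_exp_mul`): averaging
  over `z` and `-z` turns it into a nonnegative combination of the functions `cosh(2b⟪z, x⟫)`.

The first property gives `d^AI_k(n) < E‖X‖ = k/(k+1)` for `n ≥ 2`, because weighting by a strictly
decreasing function of `‖X‖` lowers the mean of `‖X‖`. Both properties together give
`v(x) ≤ exp(b(1 - ‖x‖²))` on the ball. As `1 - ‖X‖` is of order `1/k`, it follows that
`1 - d^AI_k(n) ≤ 1/k + O(1/k²)` uniformly in `n`, whereas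
`1 - d^IP_k(2) = 2/(k+1) - 1/(2k+1)` is asymptotic to `3/(2k)`.
-/

open MeasureTheory ProbabilityTheory

noncomputable section

namespace AIClones

/-! ### Gaussian averages of decreasing functions of the distance -/

section GaussianAverage

variable {V : Type*} [NormedAddCommGroup V] [InnerProductSpace ℝ V]

theorem reflection_span_singleton_orthogonal_apply (h y : V) :
    (ℝ ∙ h)ᗮ.reflection y = y - (2 * inner ℝ h y / ‖h‖ ^ 2) • h := by
  rw [Submodule.reflection_orthogonal_apply, Submodule.reflection_singleton_apply]
  simp only [RCLike.ofReal_real_eq_id, id_eq]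
  module

/-- Signs of the two brackets: both are governed by the side of the mirror on which `y` lies. -/
theorem reflection_bracket_signs {b : ℝ} (hb : 0 < b) {h m : V} (hh : h ≠ 0)
    (hm : 0 ≤ inner ℝ h m) (y : V) :
    (inner ℝ h y ≤ 0 → ‖y + h‖ ≤ ‖y - h‖ ∧
      Real.exp (-b * ‖(ℝ ∙ h)ᗮ.reflection y + m‖ ^ 2) ≤ Real.exp (-b * ‖y + m‖ ^ 2)) ∧
    (0 ≤ inner ℝ h y → ‖y - h‖ ≤ ‖y + h‖ ∧
      Real.exp (-b * ‖y + m‖ ^ 2) ≤ Real.exp (-b * ‖(ℝ ∙ h)ᗮ.reflection y + m‖ ^ 2)) ∧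
    (inner ℝ h y < 0 → 0 < inner ℝ h m → ‖y + h‖ < ‖y - h‖ ∧
      Real.exp (-b * ‖(ℝ ∙ h)ᗮ.reflection y + m‖ ^ 2) < Real.exp (-b * ‖y + m‖ ^ 2)) := by
  have hn : 0 < ‖h‖ ^ 2 := by positivity
  have d1 : ‖y + h‖ ^ 2 - ‖y - h‖ ^ 2 = 4 * inner ℝ h y := by
    rw [norm_add_sq_real, norm_sub_sq_real, real_inner_comm]; ring
  have d2 : ‖(ℝ ∙ h)ᗮ.reflection y + m‖ ^ 2 - ‖y + m‖ ^ 2 =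
      -(4 * inner ℝ h y * inner ℝ h m / ‖h‖ ^ 2) := by
    rw [norm_add_sq_real, norm_add_sq_real, LinearIsometryEquiv.norm_map,
      reflection_span_singleton_orthogonal_apply, inner_sub_left, real_inner_smul_left]
    ring
  refine ⟨fun hy => ⟨?_, ?_⟩, fun hy => ⟨?_, ?_⟩, fun hy hm' => ⟨?_, ?_⟩⟩
  · exact le_of_sq_le_sq (by linarith) (norm_nonneg _)
  · have : 4 * inner ℝ h y * inner ℝ h m / ‖h‖ ^ 2 ≤ 0 :=
      div_nonpos_of_nonpos_of_nonneg (by nlinarith) hn.le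
    exact Real.exp_le_exp.2 (by nlinarith)
  · exact le_of_sq_le_sq (by linarith) (norm_nonneg _)
  · have : 0 ≤ 4 * inner ℝ h y * inner ℝ h m / ‖h‖ ^ 2 := by positivity
    exact Real.exp_le_exp.2 (by nlinarith)
  · exact lt_of_pow_lt_pow_left₀ 2 (norm_nonneg _) (by linarith)
  · have : 4 * inner ℝ h y * inner ℝ h m / ‖h‖ ^ 2 < 0 :=
      div_neg_of_neg_of_pos (by nlinarith) hn
    exact Real.exp_lt_exp.2 (by nlinarith)

theorem exists_midpoint_data (x x' : V) :
    ∃ h m : V, x = m - h ∧ x' = m + h ∧ 4 * inner ℝ h m = ‖x'‖ ^ 2 - ‖x‖ ^ 2 := by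
  refine ⟨(1 / 2 : ℝ) • (x' - x), (1 / 2 : ℝ) • (x' + x), by module, by module, ?_⟩
  rw [real_inner_smul_left, real_inner_smul_right, inner_sub_left, inner_add_right,
    inner_add_right, real_inner_self_eq_norm_sq, real_inner_self_eq_norm_sq, real_inner_comm x x']
  ring

variable [FiniteDimensional ℝ V] [MeasurableSpace V] [BorelSpace V]

/-- The integral of `w ‖z - x‖` against the unnormalized Gaussian weight `exp (-b ‖z‖²)` centred
at the origin, as a function of `x`. -/
def gaussianAverage (b : ℝ) (w : ℝ → ℝ) (x : V) : ℝ :=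
  ∫ z : V, w ‖z - x‖ * Real.exp (-b * ‖z‖ ^ 2)

theorem integrable_mul_gaussian {b : ℝ} (hb : 0 < b) {g : V → ℝ} (hg : Measurable g) {C : ℝ}
    (hC : ∀ z, |g z| ≤ C) (m : V) :
    Integrable fun z : V => g z * Real.exp (-b * ‖z + m‖ ^ 2) := by
  have h0 : Integrable fun z : V => Real.exp (-b * ‖z‖ ^ 2) := by
    refine Integrable.of_integral_ne_zero ?_
    rw [GaussianFourier.integral_rexp_neg_mul_sq_norm hb]
    positivity
  exact (h0.comp_add_right m).bdd_mul hg.aestronglyMeasurable (Filter.Eventually.of_forall hC)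

theorem gaussianAverage_eq_shift (b : ℝ) (w : ℝ → ℝ) (x m : V) :
    gaussianAverage b w x = ∫ y : V, w ‖y - (x - m)‖ * Real.exp (-b * ‖y + m‖ ^ 2) := by
  rw [gaussianAverage,
    ← integral_add_right_eq_self (fun z : V => w ‖z - x‖ * Real.exp (-b * ‖z‖ ^ 2)) m]
  refine integral_congr_ae (Filter.Eventually.of_forall fun y => ?_)
  dsimp only
  rw [show y + m - x = y - (x - m) by abel]

/-- Twice the difference of the averages at `x` and `x'`, as the integral of a product of two
brackets. Both brackets compare a point with its mirror image in the bisector of `x` and `x'`;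
the midpoint of `x` and `x'` is moved to the origin, so that the mirror is linear. -/
theorem two_mul_gaussianAverage_sub {b : ℝ} (hb : 0 < b) {w : ℝ → ℝ} (hw : Measurable w) {C : ℝ}
    (hC : ∀ t, |w t| ≤ C) {x x' h m : V} (hx : x = m - h) (hx' : x' = m + h)
    (ρ : V ≃ₗᵢ[ℝ] V) (hρh : ρ h = -h) :
    2 * (gaussianAverage b w x - gaussianAverage b w x') =
      ∫ y : V, (w ‖y + h‖ - w ‖y - h‖) *
        (Real.exp (-b * ‖y + m‖ ^ 2) - Real.exp (-b * ‖ρ y + m‖ ^ 2)) ∧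
    Integrable fun y : V => (w ‖y + h‖ - w ‖y - h‖) *
        (Real.exp (-b * ‖y + m‖ ^ 2) - Real.exp (-b * ‖ρ y + m‖ ^ 2)) := by
  have n1 (y : V) : ‖ρ y + h‖ = ‖y - h‖ := by
    rw [← ρ.norm_map (y - h), map_sub, hρh, sub_neg_eq_add]
  have n2 (y : V) : ‖ρ y - h‖ = ‖y + h‖ := by
    rw [← ρ.norm_map (y + h), map_add, hρh, sub_eq_add_neg]
  have e1 : gaussianAverage b w x = ∫ y : V, w ‖y + h‖ * Real.exp (-b * ‖y + m‖ ^ 2) := by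
    rw [gaussianAverage_eq_shift b w x m, hx]
    simp
  have e2 : gaussianAverage b w x' = ∫ y : V, w ‖y - h‖ * Real.exp (-b * ‖y + m‖ ^ 2) := by
    rw [gaussianAverage_eq_shift b w x' m, hx']
    simp
  have hmp := ρ.measurePreserving
  have hme : MeasurableEmbedding ρ := ρ.toHomeomorph.measurableEmbedding
  have e3 : gaussianAverage b w x = ∫ y : V, w ‖y - h‖ * Real.exp (-b * ‖ρ y + m‖ ^ 2) := by
    rw [e1, ← hmp.integral_comp hme]
    simp only [n1]
  have e4 : gaussianAverage b w x' = ∫ y : V, w ‖y + h‖ * Real.exp (-b * ‖ρ y + m‖ ^ 2) := by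
    rw [e2, ← hmp.integral_comp hme]
    simp only [n2]
  have i1 : Integrable fun y : V => w ‖y + h‖ * Real.exp (-b * ‖y + m‖ ^ 2) :=
    integrable_mul_gaussian hb (hw.comp (by fun_prop)) (fun _ => hC _) m
  have i2 : Integrable fun y : V => w ‖y - h‖ * Real.exp (-b * ‖y + m‖ ^ 2) :=
    integrable_mul_gaussian hb (hw.comp (by fun_prop)) (fun _ => hC _) m
  have i3 : Integrable fun y : V => w ‖y - h‖ * Real.exp (-b * ‖ρ y + m‖ ^ 2) := by
    have := (hmp.integrable_comp_emb hme).2 i1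
    simpa only [Function.comp_def, n1] using this
  have i4 : Integrable fun y : V => w ‖y + h‖ * Real.exp (-b * ‖ρ y + m‖ ^ 2) := by
    have := (hmp.integrable_comp_emb hme).2 i2
    simpa only [Function.comp_def, n2] using this
  have key : (fun y : V => (w ‖y + h‖ - w ‖y - h‖) *
        (Real.exp (-b * ‖y + m‖ ^ 2) - Real.exp (-b * ‖ρ y + m‖ ^ 2))) = fun y =>
        (w ‖y + h‖ * Real.exp (-b * ‖y + m‖ ^ 2) - w ‖y - h‖ * Real.exp (-b * ‖y + m‖ ^ 2)) +
        (w ‖y - h‖ * Real.exp (-b * ‖ρ y + m‖ ^ 2) -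
          w ‖y + h‖ * Real.exp (-b * ‖ρ y + m‖ ^ 2)) := by
    funext y; ring
  rw [key]
  refine ⟨?_, (i1.sub i2).add (i3.sub i4)⟩
  have hadd := integral_add (i1.sub i2) (i3.sub i4)
  simp only [Pi.sub_apply] at hadd
  rw [hadd, integral_sub i1 i2, integral_sub i3 i4,
    ← e1, ← e2, ← e3, ← e4]
  ring

/-- The Gaussian average of a decreasing function of the distance to `x` decreases with `‖x‖`. -/
theorem gaussianAverage_anti {b : ℝ} (hb : 0 < b) {w : ℝ → ℝ} (hw : Antitone w) {C : ℝ}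
    (hC : ∀ t, |w t| ≤ C) {x x' : V} (hxx : ‖x‖ ≤ ‖x'‖) :
    gaussianAverage b w x' ≤ gaussianAverage b w x := by
  obtain ⟨h, m, hx, hx', hhm⟩ := exists_midpoint_data x x'
  rcases eq_or_ne h 0 with rfl | hh
  · simp only [sub_zero, add_zero] at hx hx'
    rw [hx, hx']
  have hm : 0 ≤ inner ℝ h m := by
    have := pow_le_pow_left₀ (norm_nonneg x) hxx 2
    linarith
  have key := (two_mul_gaussianAverage_sub hb hw.measurable hC hx hx' (ℝ ∙ h)ᗮ.reflection
    (Submodule.reflection_orthogonalComplement_singleton_eq_neg h)).1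
  have : 0 ≤ 2 * (gaussianAverage b w x - gaussianAverage b w x') := by
    rw [key]
    refine integral_nonneg fun y => ?_
    obtain ⟨h1, h2, -⟩ := reflection_bracket_signs hb hh hm y
    rcases le_total (inner ℝ h y) 0 with hy | hy
    · exact mul_nonneg (sub_nonneg.2 (hw (h1 hy).1)) (sub_nonneg.2 (h1 hy).2)
    · exact mul_nonneg_of_nonpos_of_nonpos (sub_nonpos.2 (hw (h2 hy).1))
        (sub_nonpos.2 (h2 hy).2)
  linarith

theorem gaussianAverage_strictAnti {b : ℝ} (hb : 0 < b) {w : ℝ → ℝ} (hw : Antitone w)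
    (hws : StrictAntiOn w (Set.Ici 0)) {C : ℝ} (hC : ∀ t, |w t| ≤ C) {x x' : V}
    (hxx : ‖x‖ < ‖x'‖) :
    gaussianAverage b w x' < gaussianAverage b w x := by
  obtain ⟨h, m, hx, hx', hhm⟩ := exists_midpoint_data x x'
  have hm : 0 < inner ℝ h m := by
    have := pow_lt_pow_left₀ hxx (norm_nonneg x) two_ne_zero
    linarith
  have hh : h ≠ 0 := by rintro rfl; simp at hm
  obtain ⟨key, hint⟩ := two_mul_gaussianAverage_sub hb hw.measurable hC hx hx'
    (ℝ ∙ h)ᗮ.reflection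
    (Submodule.reflection_orthogonalComplement_singleton_eq_neg h)
  have : 0 < 2 * (gaussianAverage b w x - gaussianAverage b w x') := by
    rw [key]
    rw [integral_pos_iff_support_of_nonneg _ hint]
    · -- The integrand is positive on the open half-space containing `x`.
      refine lt_of_lt_of_le (IsOpen.measure_pos volume (U := {y : V | inner ℝ h y < 0}) ?_ ?_)
        (measure_mono fun y hy => ?_)
      · exact isOpen_lt (by fun_prop) continuous_const
      · exact ⟨-h, by
          simpa [inner_neg_right] using pow_pos (norm_pos_iff.2 hh) 2⟩
      · obtain ⟨-, -, h3⟩ := reflection_bracket_signs hb hh hm.le y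
        obtain ⟨p, q⟩ := h3 hy hm
        exact (mul_pos (sub_pos.2 (hws (norm_nonneg _) (norm_nonneg _) p)) (sub_pos.2 q)).ne'
    · intro y
      obtain ⟨h1, h2, -⟩ := reflection_bracket_signs hb hh hm.le y
      rcases le_total (inner ℝ h y) 0 with hy | hy
      · exact mul_nonneg (sub_nonneg.2 (hw (h1 hy).1)) (sub_nonneg.2 (h1 hy).2)
      · exact mul_nonneg_of_nonpos_of_nonpos (sub_nonpos.2 (hw (h2 hy).1))
          (sub_nonpos.2 (h2 hy).2)
  linarith

/-- After removal of the factor `exp (-b ‖x‖²)`, the Gaussian average is an average of hyperbolic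
cosines `cosh (2b⟪z, x⟫)`. -/
theorem exp_mul_gaussianAverage {b : ℝ} (hb : 0 < b) {w : ℝ → ℝ} (hw : Measurable w) {C : ℝ}
    (hC : ∀ t, |w t| ≤ C) (x : V) :
    Real.exp (b * ‖x‖ ^ 2) * gaussianAverage b w x =
      ∫ z : V, w ‖z‖ * Real.exp (-b * ‖z‖ ^ 2) * Real.cosh (2 * b * inner ℝ z x) ∧
    Integrable fun z : V =>
      w ‖z‖ * Real.exp (-b * ‖z‖ ^ 2) * Real.cosh (2 * b * inner ℝ z x) := by
  have e1 : gaussianAverage b w x = ∫ z : V, w ‖z‖ * Real.exp (-b * ‖z + x‖ ^ 2) := by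
    rw [gaussianAverage_eq_shift b w x x]; simp
  have e2 : gaussianAverage b w x = ∫ z : V, w ‖z‖ * Real.exp (-b * ‖z + -x‖ ^ 2) := by
    rw [e1, ← integral_neg_eq_self]
    refine integral_congr_ae (Filter.Eventually.of_forall fun z => ?_)
    dsimp only
    rw [norm_neg, ← norm_neg (-z + x), neg_add, neg_neg]
  have i1 : Integrable fun z : V => w ‖z‖ * Real.exp (-b * ‖z + x‖ ^ 2) :=
    integrable_mul_gaussian hb (hw.comp (by fun_prop)) (fun _ => hC _) _
  have i2 : Integrable fun z : V => w ‖z‖ * Real.exp (-b * ‖z + -x‖ ^ 2) :=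
    integrable_mul_gaussian hb (hw.comp (by fun_prop)) (fun _ => hC _) _
  have key : (fun z : V => w ‖z‖ * Real.exp (-b * ‖z‖ ^ 2) * Real.cosh (2 * b * inner ℝ z x)) =
      fun z => Real.exp (b * ‖x‖ ^ 2) / 2 * (w ‖z‖ * Real.exp (-b * ‖z + x‖ ^ 2) +
        w ‖z‖ * Real.exp (-b * ‖z + -x‖ ^ 2)) := by
    funext z
    have f1 : Real.exp (b * ‖x‖ ^ 2) * Real.exp (-b * ‖z + x‖ ^ 2) =
        Real.exp (-b * ‖z‖ ^ 2) * Real.exp (-(2 * b * inner ℝ z x)) := by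
      rw [← Real.exp_add, ← Real.exp_add, norm_add_sq_real]; congr 1; ring
    have f2 : Real.exp (b * ‖x‖ ^ 2) * Real.exp (-b * ‖z + -x‖ ^ 2) =
        Real.exp (-b * ‖z‖ ^ 2) * Real.exp (2 * b * inner ℝ z x) := by
      rw [← Real.exp_add, ← Real.exp_add, norm_add_sq_real, inner_neg_right, norm_neg]
      congr 1; ring
    rw [Real.cosh_eq]
    linear_combination (-w ‖z‖ / 2) * f1 + (-w ‖z‖ / 2) * f2
  rw [key]
  refine ⟨?_, (i1.add i2).const_mul _⟩
  rw [integral_const_mul, integral_add i1 i2, ← e1, ← e2]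
  ring

/-- Moving from `x` to the nearer point `x'` raises the Gaussian average by at most the ratio of
the Gaussian weights at the two points. Collinearity costs nothing here, because the average
depends on the norm only. -/
theorem gaussianAverage_le_exp_mul {b : ℝ} (hb : 0 < b) {w : ℝ → ℝ} (hw : Antitone w)
    (hw0 : ∀ t, 0 ≤ w t) {C : ℝ} (hC : ∀ t, |w t| ≤ C) {x x' : V} (hxx : ‖x'‖ ≤ ‖x‖) :
    gaussianAverage b w x' ≤ Real.exp (b * (‖x‖ ^ 2 - ‖x'‖ ^ 2)) * gaussianAverage b w x := by
  set t : ℝ := ‖x'‖ / ‖x‖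
  have ht0 : 0 ≤ t := by positivity
  have ht1 : t ≤ 1 := div_le_one_of_le₀ hxx (norm_nonneg _)
  have hnorm : ‖t • x‖ = ‖x'‖ := by
    rw [norm_smul, Real.norm_of_nonneg ht0]
    rcases eq_or_ne ‖x‖ 0 with h | h
    · have : ‖x'‖ = 0 := le_antisymm (h ▸ hxx) (norm_nonneg _)
      rw [h, this, mul_zero]
    · exact div_mul_cancel₀ _ h
  have h1 : gaussianAverage b w x' ≤ gaussianAverage b w (t • x) :=
    gaussianAverage_anti hb hw hC hnorm.le
  obtain ⟨k1, j1⟩ := exp_mul_gaussianAverage hb hw.measurable hC (t • x)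
  obtain ⟨k2, j2⟩ := exp_mul_gaussianAverage hb hw.measurable hC x
  have h2 : Real.exp (b * ‖x'‖ ^ 2) * gaussianAverage b w (t • x) ≤
      Real.exp (b * ‖x‖ ^ 2) * gaussianAverage b w x := by
    rw [← hnorm, k1, k2]
    refine integral_mono j1 j2 fun z => ?_
    refine mul_le_mul_of_nonneg_left ?_ (mul_nonneg (hw0 _) (Real.exp_pos _).le)
    rw [Real.cosh_le_cosh, real_inner_smul_right,
      show 2 * b * (t * inner ℝ z x) = t * (2 * b * inner ℝ z x) by ring, abs_mul,
      abs_of_nonneg ht0]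
    exact mul_le_of_le_one_left (abs_nonneg _) ht1
  refine h1.trans ?_
  rw [mul_sub, Real.exp_sub, div_mul_eq_mul_div, le_div_iff₀ (Real.exp_pos _), mul_comm]
  exact h2

end GaussianAverage

/-! ### The law of the difference of the two noises -/

open Complex in
theorem charFun_gaussianNoise (σ : ℝ) (k : ℕ) (t : EuclideanSpace ℝ (Fin k)) :
    charFun (gaussianNoise σ k) t = cexp (-(σ ^ 2 * ‖t‖ ^ 2 / 2)) := by
  have hS : ((σ ^ 2) • (1 : Matrix (Fin k) (Fin k) ℝ)).PosSemidef :=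
    Matrix.PosSemidef.one.smul (sq_nonneg σ)
  rw [gaussianNoise, charFun_multivariateGaussian hS]
  congr 1
  have h2 : ∑ i, t i * t i = ‖t‖ ^ 2 := by
    rw [EuclideanSpace.real_norm_sq_eq]; simp only [sq]
  rw [Matrix.smul_mulVec, Matrix.one_mulVec, dotProduct_smul, dotProduct, h2]
  simp

instance isProbabilityMeasure_gaussianNoise (σ : ℝ) (k : ℕ) :
    IsProbabilityMeasure (gaussianNoise σ k) := by
  unfold gaussianNoise
  infer_instance

open Complex in
/-- The difference of two independent `N(0, σ² I_k)` vectors has the density of `N(0, 2σ² I_k)`. -/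
theorem map_sub_gaussianNoise {σ : ℝ} (hσ : 0 < σ) (k : ℕ) :
    ((gaussianNoise σ k).prod (gaussianNoise σ k)).map (fun p => p.2 - p.1) =
      volume.withDensity fun z => ENNReal.ofReal
        ((∫ y : EuclideanSpace ℝ (Fin k), Real.exp (-(4 * σ ^ 2)⁻¹ * ‖y‖ ^ 2))⁻¹ *
          Real.exp (-(4 * σ ^ 2)⁻¹ * ‖z‖ ^ 2)) := by
  set b : ℝ := (4 * σ ^ 2)⁻¹ with hbdef
  have hb : 0 < b := by positivity
  set Z : ℝ := ∫ y : EuclideanSpace ℝ (Fin k), Real.exp (-b * ‖y‖ ^ 2) with hZ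
  have hZpos : 0 < Z := by
    rw [hZ, GaussianFourier.integral_rexp_neg_mul_sq_norm hb]; positivity
  have hint : Integrable fun z : EuclideanSpace ℝ (Fin k) => Real.exp (-b * ‖z‖ ^ 2) :=
    Integrable.of_integral_ne_zero hZpos.ne'
  have hfin : IsFiniteMeasure (volume.withDensity fun z : EuclideanSpace ℝ (Fin k) =>
      ENNReal.ofReal (Z⁻¹ * Real.exp (-b * ‖z‖ ^ 2))) :=
    isFiniteMeasure_withDensity_ofReal (hint.const_mul _).2
  have hprob : IsProbabilityMeasure (((gaussianNoise σ k).prod (gaussianNoise σ k)).map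
      (fun p => p.2 - p.1)) := Measure.isProbabilityMeasure_map (by fun_prop)
  refine Measure.ext_of_charFun (funext fun t => ?_)
  have lhs : charFun (((gaussianNoise σ k).prod (gaussianNoise σ k)).map (fun p => p.2 - p.1)) t =
      cexp (-(σ ^ 2 * ‖t‖ ^ 2)) := by
    rw [charFun_apply, integral_map (by fun_prop) (by fun_prop)]
    have : ∀ p : EuclideanSpace ℝ (Fin k) × EuclideanSpace ℝ (Fin k),
        cexp (inner ℝ (p.2 - p.1) t * I) =
          cexp (inner ℝ p.1 (-t) * I) * cexp (inner ℝ p.2 t * I) := by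
      intro p
      rw [← Complex.exp_add, inner_sub_left, inner_neg_right]
      congr 1; push_cast; ring
    simp_rw [this]
    rw [integral_prod_mul (fun x : EuclideanSpace ℝ (Fin k) => cexp (inner ℝ x (-t) * I))
      (fun x : EuclideanSpace ℝ (Fin k) => cexp (inner ℝ x t * I)), ← charFun_apply,
      ← charFun_apply, charFun_gaussianNoise, charFun_gaussianNoise, norm_neg, ← Complex.exp_add]
    congr 1; ring
  have rhs : charFun (volume.withDensity fun z : EuclideanSpace ℝ (Fin k) =>
      ENNReal.ofReal (Z⁻¹ * Real.exp (-b * ‖z‖ ^ 2))) t = cexp (-(σ ^ 2 * ‖t‖ ^ 2)) := by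
    have hbc : 0 < (b : ℂ).re := by simpa using hb
    have hZc : (Z : ℂ) = (Real.pi / b) ^ (Module.finrank ℝ (EuclideanSpace ℝ (Fin k)) / 2 : ℂ) := by
      rw [← GaussianFourier.integral_cexp_neg_mul_sq_norm hbc, hZ, ← integral_complex_ofReal]
      simp
    have hZ0 : (Z : ℂ) ≠ 0 := by exact_mod_cast hZpos.ne'
    rw [charFun_apply, integral_withDensity_eq_integral_toReal_smul (by fun_prop)
      (Filter.Eventually.of_forall fun _ => ENNReal.ofReal_lt_top)]
    have : ∀ z : EuclideanSpace ℝ (Fin k),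
        (ENNReal.ofReal (Z⁻¹ * Real.exp (-b * ‖z‖ ^ 2))).toReal • cexp (inner ℝ z t * I) =
        (Z : ℂ)⁻¹ * cexp (-b * ‖z‖ ^ 2 + I * inner ℝ t z) := by
      intro z
      rw [ENNReal.toReal_ofReal (by positivity), Complex.real_smul, Complex.exp_add,
        real_inner_comm, mul_comm I]
      push_cast
      ring
    simp_rw [this]
    rw [integral_const_mul, GaussianFourier.integral_cexp_neg_mul_sq_norm_add hbc, ← hZc,
      inv_mul_cancel_left₀ hZ0]
    congr 1
    have : (σ : ℂ) ≠ 0 := by exact_mod_cast hσ.ne'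
    rw [hbdef, I_sq]
    push_cast
    field_simp
  rw [lhs, rhs]

/-- Expected weight of the clone distance of a candidate with attributes `x`. -/
theorem integral_comp_cloneDist {σ : ℝ} (hσ : 0 < σ) {k : ℕ} {w : ℝ → ℝ} (hw : Measurable w)
    (x : EuclideanSpace ℝ (Fin k)) :
    ∫ p, w (Candidate.cloneDist (x, p)) ∂((gaussianNoise σ k).prod (gaussianNoise σ k)) =
      (∫ y : EuclideanSpace ℝ (Fin k), Real.exp (-(4 * σ ^ 2)⁻¹ * ‖y‖ ^ 2))⁻¹ *
        gaussianAverage (4 * σ ^ 2)⁻¹ w x := by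
  have hm : Measurable fun z : EuclideanSpace ℝ (Fin k) => w ‖z - x‖ := hw.comp (by fun_prop)
  have h1 : ∀ p : EuclideanSpace ℝ (Fin k) × EuclideanSpace ℝ (Fin k),
      w (Candidate.cloneDist (x, p)) = w ‖(p.2 - p.1) - x‖ := by
    intro p
    simp only [Candidate.cloneDist, Candidate.subjectClone, Candidate.clone, subject]
    congr 2
    abel
  simp_rw [h1]
  have h2 := integral_map (μ := (gaussianNoise σ k).prod (gaussianNoise σ k))
    (φ := fun p => p.2 - p.1) (by fun_prop) hm.aestronglyMeasurable
  rw [← h2, map_sub_gaussianNoise hσ,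
    integral_withDensity_eq_integral_toReal_smul (by fun_prop)
      (Filter.Eventually.of_forall fun _ => ENNReal.ofReal_lt_top), gaussianAverage,
    ← integral_const_mul]
  refine integral_congr_ae (Filter.Eventually.of_forall fun z => ?_)
  dsimp only
  rw [ENNReal.toReal_ofReal (mul_nonneg
    (inv_nonneg.2 (integral_nonneg fun _ => (Real.exp_pos _).le)) (Real.exp_pos _).le), smul_eq_mul]
  ring

/-! ### The law of the selected candidate -/

theorem argmin_eq_iff {n : ℕ+} (s : Fin n → ℝ) (i : Fin n) :
    argmin s = i ↔ ∀ j, j ≠ i → if j < i then s i < s j else s i ≤ s j := by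
  have hmem : ∀ j, s (argmin s) ≤ s j :=
    (Finset.mem_filter.1 (Finset.min'_mem _ (exists_minimizer s))).2
  have hle : ∀ l, (∀ j, s l ≤ s j) → argmin s ≤ l := fun l hl =>
    Finset.min'_le _ _ (by simpa using hl)
  constructor
  · rintro rfl j -
    split_ifs with h
    · by_contra! hc
      exact absurd (hle j fun l => hc.trans (hmem l)) (not_le.2 h)
    · exact hmem j
  · intro h
    have hi : ∀ j, s i ≤ s j := by
      intro j
      rcases eq_or_ne j i with rfl | hj
      · exact le_rfl
      · have := h j hj
        split_ifs at this
        exacts [this.le, this]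
    by_contra hne
    have h1 := h _ hne
    rw [if_pos (lt_of_le_of_ne (hle i hi) hne)] at h1
    exact absurd (hmem i) (not_le.2 h1)

section Selection

variable {α : Type*} [MeasurableSpace α]

/-- If the score of one of `m + 1` independent candidates is `t`, this is the probability that
the candidate is selected, summed over the `m + 1` places the candidate can occupy; ties go to
the earlier place. -/
def selectionWeight (μ : Measure α) (s : α → ℝ) (m : ℕ) (t : ℝ) : ℝ :=
  ∑ i : Fin (m + 1), ∏ j : Fin m,
    μ.real {a | if i.succAbove j < i then t < s a else t ≤ s a}

theorem selectionWeight_nonneg (μ : Measure α) (s : α → ℝ) (m : ℕ) (t : ℝ) :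
    0 ≤ selectionWeight μ s m t :=
  Finset.sum_nonneg fun _ _ => Finset.prod_nonneg fun _ _ => measureReal_nonneg

theorem abs_selectionWeight_le (μ : Measure α) [IsProbabilityMeasure μ] (s : α → ℝ) (m : ℕ)
    (t : ℝ) : |selectionWeight μ s m t| ≤ m + 1 := by
  rw [abs_of_nonneg (selectionWeight_nonneg μ s m t)]
  calc selectionWeight μ s m t ≤ ∑ _i : Fin (m + 1), (1 : ℝ) :=
        Finset.sum_le_sum fun _ _ => Finset.prod_le_one (fun _ _ => measureReal_nonneg)
          fun _ _ => measureReal_le_one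
    _ = m + 1 := by simp

theorem selectionWeight_antitone (μ : Measure α) [IsProbabilityMeasure μ] (s : α → ℝ) (m : ℕ) :
    Antitone (selectionWeight μ s m) := by
  intro t t' h
  refine Finset.sum_le_sum fun i _ => Finset.prod_le_prod (fun _ _ => measureReal_nonneg)
    fun j _ => measureReal_mono fun a ha => ?_
  simp only [Set.mem_ofPred_eq] at ha ⊢
  split_ifs at ha ⊢ with hij
  exacts [h.trans_lt ha, h.trans ha]

theorem selectionWeight_strictAntiOn (μ : Measure α) [IsProbabilityMeasure μ] {s : α → ℝ}
    (hs : Measurable s) {m : ℕ} (hm : m ≠ 0)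
    (hpos : ∀ t t', 0 ≤ t → t < t' → 0 < μ {a | t < s a ∧ s a < t'}) :
    StrictAntiOn (selectionWeight μ s m) (Set.Ici 0) := by
  intro t ht t' _ htt
  have hgap : μ.real {a | t' ≤ s a} < μ.real {a | t < s a} := by
    have hd : {a | t < s a} = {a | t' ≤ s a} ∪ {a | t < s a ∧ s a < t'} := by
      ext a
      simp only [Set.mem_ofPred_eq, Set.mem_union]
      constructor
      · intro h
        rcases le_or_gt t' (s a) with h' | h'
        exacts [Or.inl h', Or.inr ⟨h, h'⟩]
      · rintro (h | h)
        exacts [htt.trans_le h, h.1]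
    rw [hd, measureReal_union]
    · have : 0 < μ.real {a | t < s a ∧ s a < t'} :=
        ENNReal.toReal_pos (hpos t t' ht htt).ne' (measure_ne_top _ _)
      linarith
    · rw [Set.disjoint_left]
      intro a h h'
      exact absurd h'.2 (not_lt.2 h)
    · exact (measurableSet_lt measurable_const hs).inter (measurableSet_lt hs measurable_const)
  have hterm : ∀ i : Fin (m + 1),
      ∏ j : Fin m, μ.real {a | if i.succAbove j < i then t' < s a else t' ≤ s a} <
      ∏ j : Fin m, μ.real {a | if i.succAbove j < i then t < s a else t ≤ s a} := by
    intro i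
    calc _ ≤ ∏ _j : Fin m, μ.real {a | t' ≤ s a} :=
          Finset.prod_le_prod (fun _ _ => measureReal_nonneg) fun j _ =>
            measureReal_mono fun a ha => by
              simp only [Set.mem_ofPred_eq] at ha ⊢
              split_ifs at ha
              exacts [ha.le, ha]
      _ < ∏ _j : Fin m, μ.real {a | t < s a} := by
          simp only [Finset.prod_const, Finset.card_univ, Fintype.card_fin]
          exact pow_lt_pow_left₀ hgap measureReal_nonneg hm
      _ ≤ _ :=
          Finset.prod_le_prod (fun _ _ => measureReal_nonneg) fun j _ =>
            measureReal_mono fun a ha => by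
              simp only [Set.mem_ofPred_eq] at ha ⊢
              split_ifs
              exacts [ha, ha.le]
  exact Finset.sum_lt_sum_of_nonempty Finset.univ_nonempty fun i _ => hterm i

theorem measurableSet_selected {s : α → ℝ} (hs : Measurable s) {m : ℕ} (i : Fin (m + 1)) :
    MeasurableSet {p : α × (Fin m → α) |
      ∀ j, if i.succAbove j < i then s p.1 < s (p.2 j) else s p.1 ≤ s (p.2 j)} := by
  rw [Set.ofPred_forall]
  refine MeasurableSet.iInter fun j => ?_
  split_ifs
  · exact measurableSet_lt (by fun_prop) (by fun_prop)
  · exact measurableSet_le (by fun_prop) (by fun_prop)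

/-- The expectation of `f` at the candidate of least score is the expectation of `f` weighted by
`selectionWeight`. -/
theorem integral_argmin (μ : Measure α) [IsProbabilityMeasure μ] {s : α → ℝ} (hs : Measurable s)
    {f : α → ℝ} (hf : Integrable f μ) (m : ℕ) :
    ∫ c : Fin m.succPNat → α, f (c (argmin fun i => s (c i))) ∂(Measure.pi fun _ => μ) =
      ∫ a, f a * selectionWeight μ s m (s a) ∂μ := by
  let S : Fin (m + 1) → Set (α × (Fin m → α)) := fun i => {p |
      ∀ j, if i.succAbove j < i then s p.1 < s (p.2 j) else s p.1 ≤ s (p.2 j)}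
  have hS : ∀ i, MeasurableSet (S i) := fun i => measurableSet_selected hs i
  let e : ∀ i : Fin (m + 1), (Fin (m + 1) → α) ≃ᵐ α × (Fin m → α) := fun i =>
    MeasurableEquiv.piFinSuccAbove (fun _ => α) i
  have he : ∀ i, MeasurePreserving (e i) (Measure.pi fun _ => μ)
      (μ.prod (Measure.pi fun _ => μ)) := fun i =>
    measurePreserving_piFinSuccAbove (fun _ : Fin (m + 1) => μ) i
  let F : Fin (m + 1) → α × (Fin m → α) → ℝ := fun i => (S i).indicator fun p => f p.1
  have hF : ∀ i, Integrable (F i) (μ.prod (Measure.pi fun _ => μ)) := fun i =>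
    (hf.comp_fst _).indicator (hS i)
  have hsum : ∀ c : Fin m.succPNat → α,
      f (c (argmin fun i => s (c i))) = ∑ i : Fin (m + 1), F i (e i c) := by
    intro c
    let A : Fin (m + 1) := argmin (n := m.succPNat) fun i => s (c i)
    have hi : ∀ i : Fin (m + 1), F i (e i c) = if A = i then f (c i) else 0 := by
      intro i
      have : e i c ∈ S i ↔ A = i := by
        change _ ↔ argmin (n := m.succPNat) (fun i => s (c i)) = i
        rw [argmin_eq_iff (n := m.succPNat) _ i]
        refine Iff.trans ?_ (Fin.forall_iff_succAbove (P := fun j => j ≠ i →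
          if j < i then s (c i) < s (c j) else s (c i) ≤ s (c j)) i).symm
        simp only [ne_eq, not_true_eq_false, false_implies, Fin.succAbove_ne, not_false_eq_true,
          true_implies, true_and]
        rfl
      by_cases h : e i c ∈ S i
      · rw [if_pos (this.1 h)]
        exact Set.indicator_of_mem h _
      · rw [if_neg (mt this.2 h)]
        exact Set.indicator_of_notMem h _
    simp_rw [hi]
    exact ((Finset.sum_ite_eq Finset.univ A (fun i => f (c i))).trans
      (if_pos (Finset.mem_univ _))).symm
  have hint : ∫ c : Fin m.succPNat → α, f (c (argmin fun i => s (c i))) ∂(Measure.pi fun _ => μ) =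
      ∫ c : Fin (m + 1) → α, ∑ i : Fin (m + 1), F i (e i c) ∂(Measure.pi fun _ => μ) :=
    integral_congr_ae (Filter.Eventually.of_forall hsum)
  have hFe : ∀ i, Integrable (fun c => F i (e i c)) (Measure.pi fun _ => μ) := fun i =>
    (he i).integrable_comp_of_integrable (hF i)
  rw [hint, integral_finsetSum _ fun i _ => hFe i]
  have hterm : ∀ i : Fin (m + 1), ∫ c, F i (e i c) ∂(Measure.pi fun _ => μ) =
      ∫ a, f a * ∏ j : Fin m,
        μ.real {a' | if i.succAbove j < i then s a < s a' else s a ≤ s a'} ∂μ := by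
    intro i
    rw [(he i).integral_comp (e i).measurableEmbedding (F i), integral_prod _ (hF i)]
    refine integral_congr_ae (Filter.Eventually.of_forall fun a => ?_)
    dsimp only
    have hbox : {c' : Fin m → α | (a, c') ∈ S i} = Set.univ.pi fun j =>
        {a' | if i.succAbove j < i then s a < s a' else s a ≤ s a'} := by
      ext c'
      simp [S, Set.mem_pi]
    have hFa : (fun c' => F i (a, c')) = {c' : Fin m → α | (a, c') ∈ S i}.indicator
        fun _ => f a := by
      funext c'
      simp only [F, Set.indicator, Set.mem_ofPred_eq]
    have hmeas : MeasurableSet {c' : Fin m → α | (a, c') ∈ S i} := measurable_prodMk_left (hS i)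
    rw [hFa, integral_indicator_const _ hmeas, hbox, smul_eq_mul,
      mul_comm, measureReal_def, Measure.pi_pi, ENNReal.toReal_prod]
    rfl
  simp_rw [hterm]
  rw [← integral_finsetSum]
  · simp only [selectionWeight, Finset.mul_sum]
  · intro i _
    refine hf.mul_bdd (c := 1) ?_ (Filter.Eventually.of_forall fun a => ?_)
    · refine (Antitone.measurable (f := fun t => ∏ j : Fin m,
        μ.real {a' | if i.succAbove j < i then t < s a' else t ≤ s a'}) ?_).comp hs
          |>.aestronglyMeasurable
      intro t t' h
      refine Finset.prod_le_prod (fun _ _ => measureReal_nonneg)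
        fun j _ => measureReal_mono fun a ha => ?_
      simp only [Set.mem_ofPred_eq] at ha ⊢
      split_ifs at ha ⊢ with hij
      exacts [h.trans_lt ha, h.trans ha]
    · rw [Real.norm_of_nonneg (Finset.prod_nonneg fun _ _ => measureReal_nonneg)]
      exact Finset.prod_le_one (fun _ _ => measureReal_nonneg) fun _ _ => measureReal_le_one

theorem integral_selectionWeight (μ : Measure α) [IsProbabilityMeasure μ] {s : α → ℝ}
    (hs : Measurable s) (m : ℕ) : ∫ a, selectionWeight μ s m (s a) ∂μ = 1 := by
  have := integral_argmin μ hs (integrable_const (1 : ℝ)) m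
  rw [integral_const, probReal_univ, one_smul] at this
  simpa only [one_mul] using this.symm

end Selection

/-! ### The uniform distribution on the ball -/

theorem nontrivial_euclideanSpace {k : ℕ} (hk : 1 ≤ k) : Nontrivial (EuclideanSpace ℝ (Fin k)) :=
  Module.nontrivial_of_finrank_pos (R := ℝ)
    (by rw [finrank_euclideanSpace, Fintype.card_fin]; omega)

theorem volume_closedBall_ne_zero (k : ℕ) :
    volume (Metric.closedBall (0 : EuclideanSpace ℝ (Fin k)) 1) ≠ 0 :=
  (Metric.measure_closedBall_pos volume 0 one_pos).ne'

theorem volume_closedBall_ne_top (k : ℕ) :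
    volume (Metric.closedBall (0 : EuclideanSpace ℝ (Fin k)) 1) ≠ ⊤ :=
  measure_closedBall_lt_top.ne

instance isProbabilityMeasure_uniformBall (k : ℕ) : IsProbabilityMeasure (uniformBall k) :=
  cond_isProbabilityMeasure_of_finite (volume_closedBall_ne_zero k) (volume_closedBall_ne_top k)

theorem uniformBall_absolutelyContinuous (k : ℕ) : uniformBall k ≪ volume :=
  cond_absolutelyContinuous

theorem ae_norm_le_one (k : ℕ) : ∀ᵐ x ∂(uniformBall k), ‖x‖ ≤ 1 := by
  filter_upwards [ae_cond_mem (μ := volume) Metric.isClosed_closedBall.measurableSet] with x hx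
  simpa using hx

theorem integrable_norm_uniformBall (k : ℕ) : Integrable (fun x => ‖x‖) (uniformBall k) :=
  Integrable.of_bound (by fun_prop) 1 (by simpa using ae_norm_le_one k)

theorem uniformBall_real_le_norm (k : ℕ) {t : ℝ} (ht : 0 < t) (ht1 : t ≤ 1) :
    (uniformBall k).real {x | t ≤ ‖x‖} = 1 - t ^ k := by
  have hball : (uniformBall k).real (Metric.ball 0 t) = t ^ k := by
    rw [measureReal_def, uniformBall, cond_apply Metric.isClosed_closedBall.measurableSet,
      Set.inter_eq_right.2
        (Metric.ball_subset_closedBall.trans (Metric.closedBall_subset_closedBall ht1)),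
      Measure.addHaar_ball_of_pos _ _ ht, ENNReal.toReal_mul, ENNReal.toReal_mul,
      ENNReal.toReal_inv, Measure.addHaar_unitClosedBall_eq_addHaar_unitBall,
      ENNReal.toReal_ofReal (by positivity), finrank_euclideanSpace, Fintype.card_fin]
    have : (volume (Metric.ball (0 : EuclideanSpace ℝ (Fin k)) 1)).toReal ≠ 0 :=
      (ENNReal.toReal_pos (Metric.measure_ball_pos volume 0 one_pos).ne'
        measure_ball_lt_top.ne).ne'
    field_simp
  rw [← hball, ← probReal_compl_eq_one_sub Metric.isOpen_ball.measurableSet]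
  congr 1
  ext x
  simp

/-- The radius of a uniform point of the ball of `ℝ^k` has density `k r^(k-1)` on `[0, 1]`. -/
theorem integral_comp_norm_uniformBall {k : ℕ} (hk : 1 ≤ k) (f : ℝ → ℝ) :
    ∫ x, f ‖x‖ ∂(uniformBall k) = k * ∫ r in (0 : ℝ)..1, r ^ (k - 1) * f r := by
  have := nontrivial_euclideanSpace hk
  have hV : volume.real (Metric.ball (0 : EuclideanSpace ℝ (Fin k)) 1) ≠ 0 :=
    (ENNReal.toReal_pos (Metric.measure_ball_pos volume 0 one_pos).ne'
      measure_ball_lt_top.ne).ne'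
  have h1 : ∫ x in Metric.closedBall (0 : EuclideanSpace ℝ (Fin k)) 1, f ‖x‖ =
      ∫ x : EuclideanSpace ℝ (Fin k), (Set.Iic (1 : ℝ)).indicator f ‖x‖ := by
    rw [← integral_indicator Metric.isClosed_closedBall.measurableSet]
    congr 1
    funext x
    simp [Set.indicator]
  have h2 : ∫ y in Set.Ioi (0 : ℝ), y ^ (k - 1) • (Set.Iic (1 : ℝ)).indicator f y =
      ∫ r in (0 : ℝ)..1, r ^ (k - 1) * f r := by
    rw [intervalIntegral.integral_of_le zero_le_one, ← Set.Ioi_inter_Iic,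
      ← setIntegral_indicator measurableSet_Iic]
    congr 1
    funext y
    simp [Set.indicator]
  rw [uniformBall, ProbabilityTheory.cond, integral_smul_measure, h1, integral_fun_norm_addHaar,
    finrank_euclideanSpace, Fintype.card_fin, h2,
    Measure.addHaar_unitClosedBall_eq_addHaar_unitBall, ENNReal.toReal_inv, ← measureReal_def]
  simp only [smul_eq_mul, nsmul_eq_mul]
  field_simp

theorem integral_norm_uniformBall {k : ℕ} (hk : 1 ≤ k) :
    ∫ x, ‖x‖ ∂(uniformBall k) = (k : ℝ) / (k + 1) := by
  obtain ⟨j, rfl⟩ := Nat.exists_eq_add_of_le' hk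
  rw [integral_comp_norm_uniformBall hk fun r => r]
  simp only [Nat.add_sub_cancel, ← pow_succ, integral_pow]
  push_cast
  simp
  ring

theorem integral_one_sub_norm_sq_uniformBall {k : ℕ} (hk : 1 ≤ k) :
    ∫ x, (1 - ‖x‖) ^ 2 ∂(uniformBall k) = 2 / (((k : ℝ) + 1) * (k + 2)) := by
  obtain ⟨j, rfl⟩ := Nat.exists_eq_add_of_le' hk
  rw [integral_comp_norm_uniformBall hk fun r => (1 - r) ^ 2]
  have : ∀ r : ℝ, r ^ (j + 1 - 1) * (1 - r) ^ 2 = r ^ j - 2 * r ^ (j + 1) + r ^ (j + 2) := by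
    intro r; rw [Nat.add_sub_cancel]; ring
  simp_rw [this]
  have hi : ∀ n : ℕ, IntervalIntegrable (fun r : ℝ => r ^ n) volume 0 1 := fun n =>
    intervalIntegral.intervalIntegrable_pow n
  rw [intervalIntegral.integral_add ((hi _).sub ((hi _).const_mul 2)) (hi _),
    intervalIntegral.integral_sub (hi _) ((hi _).const_mul 2),
    intervalIntegral.integral_const_mul, integral_pow, integral_pow, integral_pow]
  push_cast
  simp only [one_pow, ne_eq, Nat.add_eq_zero_iff, one_ne_zero, OfNat.ofNat_ne_zero, and_false,
    not_false_eq_true, zero_pow, sub_zero]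
  field_simp
  ring

/-! ### Meeting in person -/

theorem dIP_eq_integral (k : ℕ) (m : ℕ+) :
    dIP k m = ∫ t in (0 : ℝ)..1, (1 - t ^ k) ^ (m : ℕ) := by
  have hmeas : Measurable fun x : Fin m → EuclideanSpace ℝ (Fin k) =>
      Finset.univ.inf' Finset.univ_nonempty fun i => ‖x i‖ := by
    exact (Continuous.finset_inf'_apply Finset.univ_nonempty fun i _ => by fun_prop).measurable
  have hnn : ∀ x : Fin m → EuclideanSpace ℝ (Fin k),
      0 ≤ Finset.univ.inf' Finset.univ_nonempty fun i => ‖x i‖ := fun x => by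
    simp [Finset.le_inf'_iff]
  have hle : ∀ᵐ x ∂(Measure.pi fun _ : Fin m => uniformBall k),
      (Finset.univ.inf' Finset.univ_nonempty fun i => ‖x i‖) ≤ 1 := by
    have hae : ∀ᵐ x ∂(Measure.pi fun _ : Fin m => uniformBall k),
        ‖x (⟨0, m.pos⟩ : Fin m)‖ ≤ 1 :=
      (measurePreserving_eval (fun _ : Fin m => uniformBall k)
        ⟨0, m.pos⟩).quasiMeasurePreserving.ae (ae_norm_le_one k)
    filter_upwards [hae] with x hx
    exact (Finset.inf'_le _ (Finset.mem_univ _)).trans hx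
  have hint : Integrable (fun x : Fin m → EuclideanSpace ℝ (Fin k) =>
      Finset.univ.inf' Finset.univ_nonempty fun i => ‖x i‖)
      (Measure.pi fun _ : Fin m => uniformBall k) := by
    refine Integrable.of_bound hmeas.aestronglyMeasurable 1 ?_
    filter_upwards [hle] with x hx
    rwa [Real.norm_of_nonneg (hnn x)]
  simp only [dIP, subject, sub_zero]
  rw [hint.integral_eq_integral_Ioc_meas_le (Filter.Eventually.of_forall hnn) hle,
    intervalIntegral.integral_of_le zero_le_one]
  refine setIntegral_congr_fun measurableSet_Ioc fun t ht => ?_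
  have hset : {x : Fin m → EuclideanSpace ℝ (Fin k) |
      t ≤ Finset.univ.inf' Finset.univ_nonempty fun i => ‖x i‖} =
      Set.univ.pi fun _ => {x | t ≤ ‖x‖} := by
    ext x
    simp [Finset.le_inf'_iff, Set.mem_pi]
  rw [hset, measureReal_def, Measure.pi_pi, ENNReal.toReal_prod]
  simp only [← measureReal_def, uniformBall_real_le_norm k ht.1 ht.2, Finset.prod_const,
    Finset.card_univ, Fintype.card_fin]

theorem dIP_one (k : ℕ) : dIP k 1 = (k : ℝ) / (k + 1) := by
  rw [dIP_eq_integral]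
  simp only [PNat.one_coe, pow_one]
  rw [intervalIntegral.integral_sub (by simp) (intervalIntegral.intervalIntegrable_pow k),
    integral_pow]
  simp
  field_simp
  ring

theorem dIP_two (k : ℕ) : dIP k 2 = 1 - 2 / ((k : ℝ) + 1) + 1 / (2 * k + 1) := by
  rw [dIP_eq_integral]
  have : ∀ t : ℝ, (1 - t ^ k) ^ ((2 : ℕ+) : ℕ) = 1 - 2 * t ^ k + t ^ (2 * k) := by
    intro t
    rw [PNat.val_ofNat, mul_comm 2 k, pow_mul]
    ring
  simp_rw [this]
  have hi : ∀ n : ℕ, IntervalIntegrable (fun r : ℝ => r ^ n) volume 0 1 := fun n =>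
    intervalIntegral.intervalIntegrable_pow n
  have h1 : IntervalIntegrable (fun _ : ℝ => (1 : ℝ)) volume 0 1 := by simp
  rw [intervalIntegral.integral_add (h1.sub ((hi _).const_mul 2)) (hi _),
    intervalIntegral.integral_sub h1 ((hi _).const_mul 2),
    intervalIntegral.integral_const_mul, integral_pow, integral_pow]
  simp
  ring

/-! ### Meeting on the AI platform -/

instance isProbabilityMeasure_candidateLaw (σ : ℝ) (k : ℕ) :
    IsProbabilityMeasure (candidateLaw σ k) := by
  unfold candidateLaw
  infer_instance

theorem measurable_cloneDist (k : ℕ) : Measurable (Candidate.cloneDist (k := k)) := by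
  unfold Candidate.cloneDist Candidate.subjectClone Candidate.clone
  fun_prop

/-- Every interval of positive distances is charged by the law of the clone distance. -/
theorem candidateLaw_cloneDist_pos {σ : ℝ} (hσ : 0 < σ) {k : ℕ} (hk : 1 ≤ k) {t t' : ℝ}
    (ht : 0 ≤ t) (htt : t < t') :
    0 < candidateLaw σ k {a | t < a.cloneDist ∧ a.cloneDist < t'} := by
  have hnt := nontrivial_euclideanSpace hk
  have hmeas : MeasurableSet {a : Candidate k | t < a.cloneDist ∧ a.cloneDist < t'} :=
    (measurableSet_lt measurable_const (measurable_cloneDist k)).inter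
      (measurableSet_lt (measurable_cloneDist k) measurable_const)
  rw [pos_iff_ne_zero]
  intro h0
  rw [candidateLaw, Measure.measure_prod_null hmeas] at h0
  obtain ⟨x, hx⟩ := h0.exists
  let U : Set (EuclideanSpace ℝ (Fin k)) := {z | t < ‖z - x‖ ∧ ‖z - x‖ < t'}
  have hcont : Continuous fun z : EuclideanSpace ℝ (Fin k) => ‖z - x‖ := by fun_prop
  have hU : IsOpen U := (isOpen_lt continuous_const hcont).inter (isOpen_lt hcont continuous_const)
  have hUne : U.Nonempty := by
    obtain ⟨y, hy⟩ := exists_norm_eq (EuclideanSpace ℝ (Fin k))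
      (show 0 ≤ (t + t') / 2 by linarith)
    refine ⟨y + x, ?_⟩
    simp only [U, Set.mem_ofPred_eq, add_sub_cancel_right, hy]
    constructor <;> linarith
  have hpre : Prod.mk x ⁻¹' {a : Candidate k | t < a.cloneDist ∧ a.cloneDist < t'} =
      (fun p : EuclideanSpace ℝ (Fin k) × EuclideanSpace ℝ (Fin k) => p.2 - p.1) ⁻¹' U := by
    ext p
    simp only [U, Set.mem_preimage, Set.mem_ofPred_eq, Candidate.cloneDist,
      Candidate.subjectClone, Candidate.clone, subject, zero_add, sub_add_eq_sub_sub_swap]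
  dsimp only at hx
  rw [hpre, ← Measure.map_apply (by fun_prop) hU.measurableSet, map_sub_gaussianNoise hσ] at hx
  have hx' := (withDensity_apply_eq_zero (by fun_prop)).1 hx
  have hUpos := hU.measure_pos volume hUne
  refine hUpos.ne' (measure_mono_null (t := {z | _} ∩ U) (fun z hz => ⟨?_, hz⟩) hx')
  have hZ : 0 < ∫ y : EuclideanSpace ℝ (Fin k), Real.exp (-(4 * σ ^ 2)⁻¹ * ‖y‖ ^ 2) := by
    rw [GaussianFourier.integral_rexp_neg_mul_sq_norm (by positivity)]; positivity
  simp only [Set.mem_ofPred_eq, ne_eq, ENNReal.ofReal_eq_zero, not_le]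
  positivity

/-- The expected selection weight of a candidate with attributes `x`, among `m + 1` candidates:
the density of the attributes of the selected candidate with respect to the uniform
distribution. -/
def selectedDensity (σ : ℝ) (k m : ℕ) (x : EuclideanSpace ℝ (Fin k)) : ℝ :=
  ∫ p, selectionWeight (candidateLaw σ k) Candidate.cloneDist m (Candidate.cloneDist (x, p))
    ∂((gaussianNoise σ k).prod (gaussianNoise σ k))

section SelectedDensity

variable (σ : ℝ) (k m : ℕ)

theorem measurable_selectionWeight_cloneDist : Measurable fun a : Candidate k =>
    selectionWeight (candidateLaw σ k) Candidate.cloneDist m a.cloneDist :=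
  (selectionWeight_antitone _ _ _).measurable.comp (measurable_cloneDist k)

theorem measurable_selectedDensity : Measurable (selectedDensity σ k m) :=
  ((measurable_selectionWeight_cloneDist σ k m).stronglyMeasurable.integral_prod_right').measurable

theorem abs_selectedDensity_le (x : EuclideanSpace ℝ (Fin k)) :
    |selectedDensity σ k m x| ≤ m + 1 := by
  have := norm_integral_le_of_norm_le_const (μ := (gaussianNoise σ k).prod (gaussianNoise σ k))
    (f := fun p => selectionWeight (candidateLaw σ k) Candidate.cloneDist m
      (Candidate.cloneDist (x, p)))
    (Filter.Eventually.of_forall fun p => abs_selectionWeight_le (candidateLaw σ k) _ m _)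
  simpa [selectedDensity] using this

theorem integrable_mul_selectedDensity {f : EuclideanSpace ℝ (Fin k) → ℝ}
    (hf : Integrable f (uniformBall k)) :
    Integrable (fun x => f x * selectedDensity σ k m x) (uniformBall k) :=
  hf.mul_bdd (measurable_selectedDensity σ k m).aestronglyMeasurable
    (Filter.Eventually.of_forall (abs_selectedDensity_le σ k m))

theorem integral_mul_selectedDensity {f : EuclideanSpace ℝ (Fin k) → ℝ}
    (hf : Integrable f (uniformBall k)) :
    ∫ a : Candidate k, f a.attributes *
        selectionWeight (candidateLaw σ k) Candidate.cloneDist m a.cloneDist ∂(candidateLaw σ k) =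
      ∫ x, f x * selectedDensity σ k m x ∂(uniformBall k) := by
  have hint : Integrable (fun a : Candidate k => f a.attributes *
      selectionWeight (candidateLaw σ k) Candidate.cloneDist m a.cloneDist) (candidateLaw σ k) := by
    refine Integrable.mul_bdd (c := m + 1) ?_
      (measurable_selectionWeight_cloneDist σ k m).aestronglyMeasurable
      (Filter.Eventually.of_forall fun a => abs_selectionWeight_le _ _ _ _)
    exact hf.comp_fst _
  refine (integral_prod _ hint).trans ?_
  simp only [Candidate.attributes, integral_const_mul]
  rfl

theorem integral_selectedDensity : ∫ x, selectedDensity σ k m x ∂(uniformBall k) = 1 := by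
  have h := integral_mul_selectedDensity σ k m (integrable_const (1 : ℝ))
  simp only [one_mul] at h
  rw [← h, integral_selectionWeight _ (measurable_cloneDist k)]

theorem dAI_eq_integral :
    dAI σ k m.succPNat = ∫ x, ‖x‖ * selectedDensity σ k m x ∂(uniformBall k) := by
  have hf := integrable_norm_uniformBall k
  rw [← integral_mul_selectedDensity σ k m hf,
    ← integral_argmin (candidateLaw σ k) (measurable_cloneDist k)
      (f := fun a => ‖a.attributes‖) (hf.comp_fst _) m]
  simp only [dAI, subject, sub_zero]

variable {σ}

theorem selectedDensity_anti (hσ : 0 < σ) {x x' : EuclideanSpace ℝ (Fin k)}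
    (h : ‖x‖ ≤ ‖x'‖) : selectedDensity σ k m x' ≤ selectedDensity σ k m x := by
  have hw := selectionWeight_antitone (candidateLaw σ k) Candidate.cloneDist m
  rw [selectedDensity, selectedDensity, integral_comp_cloneDist hσ hw.measurable,
    integral_comp_cloneDist hσ hw.measurable]
  exact mul_le_mul_of_nonneg_left
    (gaussianAverage_anti (by positivity) hw (abs_selectionWeight_le _ _ _) h)
    (inv_nonneg.2 (integral_nonneg fun _ => (Real.exp_pos _).le))

theorem selectedDensity_strictAnti (hσ : 0 < σ) (hk : 1 ≤ k) (hm : m ≠ 0)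
    {x x' : EuclideanSpace ℝ (Fin k)} (h : ‖x‖ < ‖x'‖) :
    selectedDensity σ k m x' < selectedDensity σ k m x := by
  have hw := selectionWeight_antitone (candidateLaw σ k) Candidate.cloneDist m
  have hws := selectionWeight_strictAntiOn (candidateLaw σ k) (measurable_cloneDist k) hm
    fun t t' ht htt => candidateLaw_cloneDist_pos hσ hk ht htt
  rw [selectedDensity, selectedDensity, integral_comp_cloneDist hσ hw.measurable,
    integral_comp_cloneDist hσ hw.measurable]
  refine mul_lt_mul_of_pos_left
    (gaussianAverage_strictAnti (by positivity) hw hws (abs_selectionWeight_le _ _ _) h)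
    (inv_pos.2 ?_)
  rw [GaussianFourier.integral_rexp_neg_mul_sq_norm (by positivity)]
  positivity

theorem selectedDensity_le_exp_mul (hσ : 0 < σ) {x x' : EuclideanSpace ℝ (Fin k)}
    (h : ‖x'‖ ≤ ‖x‖) : selectedDensity σ k m x' ≤
      Real.exp ((4 * σ ^ 2)⁻¹ * (‖x‖ ^ 2 - ‖x'‖ ^ 2)) * selectedDensity σ k m x := by
  have hw := selectionWeight_antitone (candidateLaw σ k) Candidate.cloneDist m
  rw [selectedDensity, selectedDensity, integral_comp_cloneDist hσ hw.measurable,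
    integral_comp_cloneDist hσ hw.measurable, mul_left_comm]
  exact mul_le_mul_of_nonneg_left
    (gaussianAverage_le_exp_mul (by positivity) hw (selectionWeight_nonneg _ _ _)
      (abs_selectionWeight_le _ _ _) h)
    (inv_nonneg.2 (integral_nonneg fun _ => (Real.exp_pos _).le))

end SelectedDensity

theorem dAI_one (σ : ℝ) {k : ℕ} (hk : 1 ≤ k) : dAI σ k 1 = (k : ℝ) / (k + 1) := by
  have h := dAI_eq_integral σ k 0
  have h1 : ∀ x, selectedDensity σ k 0 x = 1 := fun x => by
    simp [selectedDensity, selectionWeight]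
  simp only [h1, mul_one, integral_norm_uniformBall hk] at h
  exact h

/-- With a choice of at least two candidates, selection favours small norms: comparison with the
mean norm `k / (k + 1)` gives a strict Chebyshev-type inequality. -/
theorem dAI_lt {σ : ℝ} (hσ : 0 < σ) {k : ℕ} (hk : 1 ≤ k) {m : ℕ} (hm : m ≠ 0) :
    dAI σ k m.succPNat < (k : ℝ) / (k + 1) := by
  have hnt := nontrivial_euclideanSpace hk
  set r : ℝ := (k : ℝ) / (k + 1) with hr
  obtain ⟨e, he⟩ := exists_norm_eq (EuclideanSpace ℝ (Fin k))
    (show 0 ≤ r by positivity)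
  let v := selectedDensity σ k m
  have hn := integrable_norm_uniformBall k
  have i1 : Integrable (fun x => (r - ‖x‖) * v x) (uniformBall k) :=
    integrable_mul_selectedDensity σ k m ((integrable_const r).sub hn)
  have i2 : Integrable (fun x => (r - ‖x‖) * v e) (uniformBall k) :=
    ((integrable_const r).sub hn).mul_const _
  have hlt : ∀ x, ‖x‖ ≠ r → 0 < (r - ‖x‖) * v x - (r - ‖x‖) * v e := by
    intro x hx
    rw [← mul_sub]
    rcases lt_or_gt_of_ne hx with h | h
    · exact mul_pos (sub_pos.2 h)
        (sub_pos.2 (selectedDensity_strictAnti k m hσ hk hm (he ▸ h)))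
    · exact mul_pos_of_neg_of_neg (sub_neg.2 h)
        (sub_neg.2 (selectedDensity_strictAnti k m hσ hk hm (he ▸ h)))
  have hnn : ∀ x, 0 ≤ (r - ‖x‖) * v x - (r - ‖x‖) * v e := by
    intro x
    rcases eq_or_ne ‖x‖ r with h | h
    · simp [h]
    · exact (hlt x h).le
  have hval : ∫ x, ((r - ‖x‖) * v x - (r - ‖x‖) * v e) ∂(uniformBall k) =
      r - dAI σ k m.succPNat := by
    have hv : Integrable v (uniformBall k) := by
      simpa using integrable_mul_selectedDensity σ k m (integrable_const (1 : ℝ))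
    have h1 : ∫ x, (r - ‖x‖) * v x ∂(uniformBall k) = r - dAI σ k m.succPNat := by
      simp_rw [sub_mul]
      rw [integral_sub (hv.const_mul r) (integrable_mul_selectedDensity σ k m hn),
        integral_const_mul, integral_selectedDensity, ← dAI_eq_integral, mul_one]
    have h2 : ∫ x, (r - ‖x‖) * v e ∂(uniformBall k) = 0 := by
      rw [integral_mul_const, integral_sub (integrable_const r) hn, integral_norm_uniformBall hk]
      simp [hr]
    rw [integral_sub i1 i2, h1, h2, sub_zero]
  by_contra! hc
  have hzero : ∫ x, ((r - ‖x‖) * v x - (r - ‖x‖) * v e) ∂(uniformBall k) = 0 :=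
    le_antisymm (by rw [hval]; linarith) (integral_nonneg hnn)
  rw [integral_eq_zero_iff_of_nonneg hnn (i1.sub i2)] at hzero
  have hsphere : ∀ᵐ x ∂(uniformBall k), x ∉ Metric.sphere (0 : EuclideanSpace ℝ (Fin k)) r :=
    measure_eq_zero_iff_ae_notMem.1
      (uniformBall_absolutelyContinuous k (Measure.addHaar_sphere volume 0 r))
  obtain ⟨x, hx, hx'⟩ := (hzero.and hsphere).exists
  exact (hlt x (by simpa using hx')).ne' hx

/-- A lower bound for the AI platform that is uniform in the number of candidates. The deficit
`1 - ‖X‖` of the selected candidate has mean at most `E[(1 - R) exp (b (1 - R²))]`, where `R` is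
the norm of a uniform point and `b = (4σ²)⁻¹`; the exponential is close to one, because `R` is. -/
theorem le_dAI {σ : ℝ} (hσ : 0 < σ) {k : ℕ} (hk : 1 ≤ k) (m : ℕ) {A : ℝ}
    (hA : A = (2 * σ ^ 2)⁻¹ * Real.exp (2 * σ ^ 2)⁻¹) :
    1 - 1 / ((k : ℝ) + 1) - A * (2 / (((k : ℝ) + 1) * (k + 2))) ≤ dAI σ k m.succPNat := by
  have hnt := nontrivial_euclideanSpace hk
  obtain ⟨e, he⟩ := exists_norm_eq (EuclideanSpace ℝ (Fin k)) zero_le_one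
  let v := selectedDensity σ k m
  have hn := integrable_norm_uniformBall k
  have hv : Integrable v (uniformBall k) := by
    simpa using integrable_mul_selectedDensity σ k m (integrable_const (1 : ℝ))
  -- The density is least on the unit sphere, hence at most its mean there.
  have hve : v e ≤ 1 := by
    rw [← integral_selectedDensity σ k m]
    have : ∫ _x, v e ∂(uniformBall k) ≤ ∫ x, v x ∂(uniformBall k) := by
      refine integral_mono_ae (integrable_const _) hv ?_
      filter_upwards [ae_norm_le_one k] with x hx
      exact selectedDensity_anti k m hσ (he ▸ hx)
    simpa using this
  have hexp : ∀ r : ℝ, 0 ≤ r → r ≤ 1 →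
      Real.exp ((4 * σ ^ 2)⁻¹ * (1 ^ 2 - r ^ 2)) ≤ 1 + A * (1 - r) := by
    intro r hr hr1
    set a : ℝ := (2 * σ ^ 2)⁻¹ with ha
    have ha0 : 0 < a := by positivity
    have hab : (4 * σ ^ 2)⁻¹ = a / 2 := by rw [ha]; field_simp; norm_num
    rw [hab]
    set y : ℝ := a / 2 * (1 ^ 2 - r ^ 2) with hy
    have hy0 : 0 ≤ y := by rw [hy]; apply mul_nonneg <;> nlinarith
    have hya : y ≤ a * (1 - r) := by rw [hy]; nlinarith [mul_nonneg ha0.le (sq_nonneg (1 - r))]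
    have hya' : y ≤ a := hya.trans (by nlinarith)
    have h1 : Real.exp y ≤ 1 + y * Real.exp y := by
      have h := Real.add_one_le_exp (-y)
      have h' : Real.exp (-y) * Real.exp y = 1 := by rw [← Real.exp_add]; simp
      nlinarith [Real.exp_pos y]
    calc Real.exp y ≤ 1 + y * Real.exp y := h1
      _ ≤ 1 + a * (1 - r) * Real.exp a := by gcongr
      _ = 1 + A * (1 - r) := by rw [hA]; ring
  have i1 : Integrable (fun x => (1 - ‖x‖) * v x) (uniformBall k) :=
    integrable_mul_selectedDensity σ k m ((integrable_const 1).sub hn)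
  have isq : Integrable (fun x => (1 - ‖x‖) ^ 2) (uniformBall k) := by
    refine Integrable.of_bound (by fun_prop) 1 ?_
    filter_upwards [ae_norm_le_one k] with x hx
    rw [Real.norm_of_nonneg (sq_nonneg _)]
    nlinarith [norm_nonneg x]
  have i2 : Integrable (fun x => (1 - ‖x‖) + A * (1 - ‖x‖) ^ 2) (uniformBall k) :=
    ((integrable_const 1).sub hn).add (isq.const_mul A)
  have hmono : ∫ x, (1 - ‖x‖) * v x ∂(uniformBall k) ≤
      ∫ x, ((1 - ‖x‖) + A * (1 - ‖x‖) ^ 2) ∂(uniformBall k) := by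
    refine integral_mono_ae i1 i2 ?_
    filter_upwards [ae_norm_le_one k] with x hx
    have h1 : v x ≤ Real.exp ((4 * σ ^ 2)⁻¹ * (1 ^ 2 - ‖x‖ ^ 2)) * v e := by
      have := selectedDensity_le_exp_mul k m hσ (x := e) (x' := x) (he.symm ▸ hx)
      rwa [he] at this
    have h2 : v x ≤ 1 + A * (1 - ‖x‖) :=
      (h1.trans (mul_le_of_le_one_right (Real.exp_pos _).le hve)).trans
        (hexp _ (norm_nonneg x) hx)
    calc (1 - ‖x‖) * v x ≤ (1 - ‖x‖) * (1 + A * (1 - ‖x‖)) :=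
          mul_le_mul_of_nonneg_left h2 (sub_nonneg.2 hx)
      _ = (1 - ‖x‖) + A * (1 - ‖x‖) ^ 2 := by ring
  have hl : ∫ x, (1 - ‖x‖) * v x ∂(uniformBall k) = 1 - dAI σ k m.succPNat := by
    simp_rw [sub_mul, one_mul]
    rw [integral_sub hv (integrable_mul_selectedDensity σ k m hn), integral_selectedDensity,
      ← dAI_eq_integral]
  have hrr : ∫ x, ((1 - ‖x‖) + A * (1 - ‖x‖) ^ 2) ∂(uniformBall k) =
      1 / ((k : ℝ) + 1) + A * (2 / (((k : ℝ) + 1) * (k + 2))) := by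
    rw [integral_add (f := fun x => 1 - ‖x‖) ((integrable_const 1).sub hn) (isq.const_mul A),
      integral_const_mul, integral_one_sub_norm_sq_uniformBall hk,
      integral_sub (integrable_const 1) hn, integral_norm_uniformBall hk]
    simp only [integral_const, probReal_univ, one_smul]
    congr 1
    field_simp
    ring
  rw [hl, hrr] at hmono
  linarith

/-- To first order in `1 / k` the deficit `1 - d^IP_k(2)` is `3 / (2k)`, and `1 - d^AI_k(n)` is at
most `1 / k`, uniformly in `n`. -/
theorem dIP_two_lt_dAI {σ : ℝ} (hσ : 0 < σ) {k : ℕ} (hk : 1 ≤ k)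
    (hkσ : 6 * ((2 * σ ^ 2)⁻¹ * Real.exp (2 * σ ^ 2)⁻¹) ≤ k) (n : ℕ+) :
    dIP k 2 < dAI σ k n := by
  obtain ⟨m, rfl⟩ : ∃ m : ℕ, n = m.succPNat := ⟨n.natPred, (PNat.succPNat_natPred n).symm⟩
  refine lt_of_lt_of_le ?_ (le_dAI hσ hk m rfl)
  set A : ℝ := (2 * σ ^ 2)⁻¹ * Real.exp (2 * σ ^ 2)⁻¹
  have hk' : (1 : ℝ) ≤ k := by exact_mod_cast hk
  rw [dIP_two]
  have h1 : A * (2 / (((k : ℝ) + 1) * (k + 2))) < 1 / 3 * (1 / (k + 1)) := by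
    rw [← mul_div_assoc, ← mul_div_assoc, div_lt_div_iff₀ (by positivity) (by positivity)]
    nlinarith
  have h2 : 1 / (2 * (k : ℝ) + 1) ≤ 2 / 3 * (1 / (k + 1)) := by
    rw [← mul_div_assoc, div_le_div_iff₀ (by positivity) (by positivity)]
    linarith
  have h3 : 2 / ((k : ℝ) + 1) = 2 * (1 / (k + 1)) := by ring
  rw [h3]
  linarith

end AIClones

end

theorem theorem1 (σ : ℝ) (hσ : 0 < σ) :
    (∃ K : ℕ, ∀ k : ℕ, K ≤ k →
      AIClones.aiEquivalentSampleSize σ k = 2 ∧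
        ∀ n : ℕ+, AIClones.dIP k 2 < AIClones.dAI σ k n) ∧
    (∀ k : ℕ, 1 ≤ k →
      AIClones.dIP k 1 = (k : ℝ) / (k + 1) ∧
        AIClones.dAI σ k 1 = (k : ℝ) / (k + 1) ∧
        ∀ n : ℕ+, 2 ≤ n → AIClones.dAI σ k n < (k : ℝ) / (k + 1)) := by
  constructor
  · refine ⟨max 1 ⌈6 * ((2 * σ ^ 2)⁻¹ * Real.exp (2 * σ ^ 2)⁻¹)⌉₊, fun k hK => ?_⟩
    have hk : 1 ≤ k := (le_max_left _ _).trans hK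
    have h2 := AIClones.dIP_two_lt_dAI hσ hk (Nat.ceil_le.1 ((le_max_right _ _).trans hK))
    refine ⟨le_antisymm (sInf_le ⟨2, rfl, h2⟩) (le_sInf ?_), h2⟩
    rintro _ ⟨m, rfl, hm⟩
    -- A single meeting is excluded, because it ties with a single candidate.
    have hm1 : m ≠ 1 := by
      rintro rfl
      have := hm 1
      rw [AIClones.dIP_one, AIClones.dAI_one σ hk] at this
      exact lt_irrefl _ this
    have hm2 : 2 ≤ (m : ℕ) := by
      have h0 := m.pos
      have h1 : (m : ℕ) ≠ 1 := fun h => hm1 (PNat.coe_eq_one_iff.1 h)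
      omega
    exact_mod_cast hm2
  · intro k hk
    refine ⟨AIClones.dIP_one k, AIClones.dAI_one σ hk, fun n hn => ?_⟩
    rw [← PNat.succPNat_natPred n]
    refine AIClones.dAI_lt hσ hk ?_
    have h2 : (2 : ℕ) ≤ (n : ℕ) := hn
    have h3 := PNat.natPred_add_one n
    omega
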